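/- Let $m\ge 1$ and let $\mathcal T_1,\mathcal T_2$ be independent, each uniformly distributed on the set of (rooted, plane) binary trees with $m$ nodes, in which every node has an optional left and an optional right child. Let $\mathcal U$ be uniformly distributed on the set of binary trees with $2m$ nodes. Let $\mathcal T_1\oplus\mathcal T_2$ (resp. $\mathcal T_1\ominus\mathcal T_2$) be the tree obtained by attaching the root of $\mathcal T_2$ by an edge to the last node of the top right (resp. top left) edge of $\mathcal T_1$, i.e. of the path that starts at the root and always goes to the right (resp. left) child. The Horton–Strahler number $\operatorname{HS}(\mathcal T)$ is the number of the root when the nodes are numbered recursively: a leaf (a node without children) gets $0$, a node with exactly one child gets the number of that child, and a node with two children with numbers $a,b$ gets $\max(a,b)+\mathbf 1_{a=b}$. Let $\operatorname{HS}'(\mathcal T)$ be the Horton–Strahler number of the full binary tree with internal nodes $\mathcal T$, i.e. every missing child is replaced by an external leaf with number $0$, and the rule $\max(a,b)+\mathbf 1_{a=b}$ is used at every node of $\mathcal T$. The support of an integer-valued random variable is the set of values that it takes with positive probability. For $\star\in\{\oplus,\ominus\}$: 1. For every $m\ge1$, $\operatorname{HS}(\mathcal T_1\star\mathcal T_2)$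 has the same support as $\operatorname{HS}(\mathcal U)$, namely $\{0,1,\dots,\lfloor\log_2(2m+1)\rfloor-1\}$; and $\operatorname{HS}'(\mathcal T_1\star\mathcal T_2)$ has the same support as $\operatorname{HS}'(\mathcal U)$, namely $\{1,\dots,\lfloor\log_2(2m+1)\rfloor\}$. In particular the sharp upper bound is $\lfloor\log_2(2m+1)\rfloor$ for $\operatorname{HS}'$, and one less for $\operatorname{HS}$. 2. The first order scaling is the same as for $\mathcal U$: as $m\to\infty$, $$\frac{\operatorname{HS}(\mathcal T_1\star\mathcal T_2)}{\log_4(2m)}\to1\quad\text{and}\quad \frac{\operatorname{HS}(\mathcal U)}{\log_4(2m)}\to1\quad\text{in probability},$$ and the same holds with $\operatorname{HS}'$ in place of $\operatorname{HS}$. -/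

import Mathlib

open MeasureTheory ProbabilityTheory Filter Topology

namespace BlockTree

/-- Shapes of binary trees: `.nil` is the empty tree, and `.node () l r` is a root with left
subtree `l` and right subtree `r` (either may be empty, meaning that the child does not exist). -/
abbrev Shape : Type := BinaryTree Unit

/-- Tree shapes form a discrete (countable) measurable space. -/
instance : MeasurableSpace Shape := ⊤

/-- `T₁ ⊕ T₂`: attach the root of `T₂` by an edge to the end of the top right edge (rightmost
path starting at the root) of `T₁`. -/
def directSum : Shape → Shape → Shape
  | .nil, s => s
  | .node a l r, s => .node a l (directSum r s)

/-- `T₁ ⊖ T₂`: attach the root of `T₂` by an edge to the end of the top left edge (leftmost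
path starting at the root) of `T₁`. -/
def skewSum : Shape → Shape → Shape
  | .nil, s => s
  | .node a l r, s => .node a (skewSum l s) r

/-- Horton–Strahler number, labelling the nodes of the tree itself: a leaf (a node without
children) has number `0`, a node with one child inherits the number of this child, and a node with
two children has the maximum of their numbers, increased by one if the two are equal.
(The value `0` for the empty tree is a convention.) -/
def hs : Shape → ℕ
  | .nil => 0
  | .node _ .nil .nil => 0
  | .node _ l .nil => hs l
  | .node _ .nil r => hs r
  | .node _ l r => max (hs l) (hs r) + if hs l = hs r then 1 else 0

/-- Horton–Strahler number (register function) of the full binary tree whose internal nodes form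
the given tree: each missing child is an external leaf with number `0`, and every node of the given
tree has two children. -/
def hsFull : Shape → ℕ
  | .nil => 0
  | .node _ l r => max (hsFull l) (hsFull r) + if hsFull l = hsFull r then 1 else 0

/-- `T` is an equiprobable binary tree with `m` nodes: its law is uniform on all binary tree
shapes with `m` nodes. -/
def IsEBT {Ω : Type*} [MeasurableSpace Ω] (P : Measure Ω) (m : ℕ) (T : Ω → Shape) : Prop :=
  HasLaw T (uniformOn {t : Shape | t.numNodes = m}) P

/-- The support of an integer-valued random variable: the values of positive probability. -/
def valueSupport {Ω : Type*} [MeasurableSpace Ω] (P : Measure Ω) (X : Ω → ℕ) : Set ℕ :=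
  {k | 0 < P {ω | X ω = k}}

/-- Convergence in probability to a constant of a sequence of real random variables, the `m`-th of
which lives on its own probability space `(Ω m, P m)`. -/
def TendstoInProb {Ω : ℕ → Type*} [∀ m, MeasurableSpace (Ω m)] (P : ∀ m, Measure (Ω m))
    (X : ∀ m, Ω m → ℝ) (c : ℝ) : Prop :=
  ∀ ε : ℝ, 0 < ε → Tendsto (fun m => P m {ω | ε ≤ |X m ω - c|}) atTop (𝓝 0)

end BlockTree

namespace BlockTree

open BinaryTree

/-! On nonempty trees `hsFull` is `hs` plus one, so everything reduces to `hsFull`. For the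
supports, a tree with number `k` has at least `2^k - 1` nodes, and independence gives every pair of
trees with `m` nodes positive mass, so it remains to build one pair for each admissible value. For
the scaling, gluing yields at least the maximum of the two numbers and at most one more, so the weak
law for a single uniform tree with `m` nodes suffices: `log₄ m` and `log₄ (2m)` differ by a
constant.

That weak law comes from generating functions. Let `R_k(z)` count the trees with number `k` by
nodes. Splitting at the root gives `R_{k+1} = z (R_k² + 2 R_{k+1} ∑_{j ≤ k} R_j)`, solved by `R_k =
sin 2θ / sin (2^(k+1) θ)` with `z = 1 / (4 cos² θ)`. Each choice of `θ` bounds coefficients: real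
`θ` of order `2^(-k)` bounds the lower tail (`card_hsFull_le_le`), imaginary `θ` of modulus
`n^(-1/2)` the upper tail (`card_hsFull_eq_le`). The resulting stretched-exponential bounds absorb
the polynomial gap between `4^n` and the Catalan number. -/

instance : DiscreteMeasurableSpace Shape := ⟨fun _ => trivial⟩

/-! ### Range of the Horton–Strahler number for a given size -/

theorem hsFull_eq_hs_add_one {t : Shape} (h : t ≠ .nil) : hsFull t = hs t + 1 := by
  induction t with
  | nil => exact absurd rfl h
  | node a l r ihl ihr =>
    cases l <;> cases r
    · simp [hs, hsFull]
    · rw [hsFull, ihr (by simp)]; simp [hs, hsFull]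
    · rw [hsFull, ihl (by simp)]; simp [hs, hsFull]
    · rw [hsFull, ihl (by simp), ihr (by simp)]
      simp only [hs, Nat.add_right_cancel_iff]
      omega

theorem two_pow_hsFull_le (t : Shape) : 2 ^ hsFull t ≤ t.numNodes + 1 := by
  induction t with
  | nil => simp [hsFull]
  | node a l r ihl ihr =>
    rw [hsFull, numNodes]
    split_ifs with h
    · rw [h, max_self, pow_succ]; rw [h] at ihl; omega
    · rcases max_choice (hsFull l) (hsFull r) with h' | h' <;> rw [h', add_zero] <;> omega

theorem one_le_hsFull {t : Shape} (h : t ≠ .nil) : 1 ≤ hsFull t := by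
  rw [hsFull_eq_hs_add_one h]; omega

theorem ne_nil_of_numNodes_pos {t : Shape} (h : 0 < t.numNodes) : t ≠ .nil := by
  rintro rfl; simp at h

theorem exists_numNodes_hsFull_eq (j n : ℕ) (hj : 1 ≤ j) (hn : 2 ^ j ≤ n + 1) :
    ∃ t : Shape, t.numNodes = n ∧ hsFull t = j := by
  induction j, hj using Nat.le_induction generalizing n with
  | base =>
    have h1 : 1 ≤ n := by omega
    clear hn
    induction n, h1 using Nat.le_induction with
    | base => exact ⟨.node () .nil .nil, by simp, by simp [hsFull]⟩
    | succ n _ ih =>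
      obtain ⟨t, ht, ht'⟩ := ih
      exact ⟨.node () t .nil, by simp [ht], by simp [hsFull, ht']⟩
  | succ j hj ih =>
    rw [pow_succ] at hn
    have hp : 0 < 2 ^ j := by positivity
    -- The left subtree has the least size allowing number `j`; the right one takes all other nodes.
    obtain ⟨l, hl, hl'⟩ := ih (2 ^ j - 1) (by omega)
    obtain ⟨r, hr, hr'⟩ := ih (n - 2 ^ j) (by omega)
    exact ⟨.node () l r, by simp only [numNodes]; omega, by simp [hsFull, hl', hr']⟩

/-! ### Effect of gluing -/

theorem numNodes_directSum (t s : Shape) :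
    (directSum t s).numNodes = t.numNodes + s.numNodes := by
  induction t with
  | nil => simp [directSum]
  | node a l r _ ih => rw [directSum, numNodes, numNodes, ih]; omega

theorem numNodes_skewSum (t s : Shape) :
    (skewSum t s).numNodes = t.numNodes + s.numNodes := by
  induction t with
  | nil => simp [skewSum]
  | node a l r ih _ => rw [skewSum, numNodes, numNodes, ih]; omega

theorem max_le_hsFull_directSum (t s : Shape) :
    max (hsFull t) (hsFull s) ≤ hsFull (directSum t s) := by
  induction t with
  | nil => simp [directSum, hsFull]
  | node a l r _ ih => rw [directSum, hsFull, hsFull]; split_ifs <;> omega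

theorem max_le_hsFull_skewSum (t s : Shape) :
    max (hsFull t) (hsFull s) ≤ hsFull (skewSum t s) := by
  induction t with
  | nil => simp [skewSum, hsFull]
  | node a l r ih _ => rw [skewSum, hsFull, hsFull]; split_ifs <;> omega

/-- Increments do not accumulate along the right edge: one at the root needs the new right subtree
to tie with `l`, so the result is `hsFull l + 1`, and `hsFull l` is at most the number of the
original tree. -/
theorem hsFull_directSum_le (t s : Shape) :
    hsFull (directSum t s) ≤ max (hsFull t) (hsFull s) + 1 := by
  induction t with
  | nil => simp [directSum, hsFull]
  | node a l r _ ih => rw [directSum, hsFull, hsFull]; split_ifs <;> omega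

theorem hsFull_skewSum_le (t s : Shape) :
    hsFull (skewSum t s) ≤ max (hsFull t) (hsFull s) + 1 := by
  induction t with
  | nil => simp [skewSum, hsFull]
  | node a l r ih _ => rw [skewSum, hsFull, hsFull]; split_ifs <;> omega

theorem exists_hsFull_directSum_eq {m k : ℕ} (hm : 1 ≤ m) (hk : 1 ≤ k)
    (hkm : 2 ^ k ≤ 2 * m + 1) :
    ∃ t s : Shape, t.numNodes = m ∧ s.numNodes = m ∧ hsFull (directSum t s) = k := by
  -- The value 1 is separate because only the empty tree has number 0; here the first tree is a path
  -- to the right.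
  obtain rfl | hk := hk.eq_or_lt
  · obtain ⟨s, hs, hs'⟩ := exists_numNodes_hsFull_eq 1 m le_rfl (by omega)
    suffices h : ∀ n : ℕ, ∃ t : Shape, t.numNodes = n ∧ hsFull (directSum t s) = 1 by
      obtain ⟨t, ht, ht'⟩ := h m
      exact ⟨t, s, ht, hs, ht'⟩
    intro n
    induction n with
    | zero => exact ⟨.nil, by simp, by simpa [directSum] using hs'⟩
    | succ n ih =>
      obtain ⟨t, ht, ht'⟩ := ih
      exact ⟨.node () .nil t, by simp [ht], by simp [directSum, hsFull, ht']⟩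
  · obtain ⟨j, rfl⟩ : ∃ j, k = j + 1 := ⟨k - 1, by omega⟩
    rw [pow_succ] at hkm
    -- A root without right child is its own right edge, so `s` becomes its right child and ties
    -- with `l`. By parity, `2^j * 2 ≤ 2m + 1` gives `2^j ≤ m`.
    obtain ⟨l, hl, hl'⟩ := exists_numNodes_hsFull_eq j (m - 1) (by omega) (by omega)
    obtain ⟨s, hs, hs'⟩ := exists_numNodes_hsFull_eq j m (by omega) (by omega)
    exact ⟨.node () l .nil, s, by simp only [numNodes]; omega, hs,
      by simp [directSum, hsFull, hl', hs']⟩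

theorem exists_hsFull_skewSum_eq {m k : ℕ} (hm : 1 ≤ m) (hk : 1 ≤ k)
    (hkm : 2 ^ k ≤ 2 * m + 1) :
    ∃ t s : Shape, t.numNodes = m ∧ s.numNodes = m ∧ hsFull (skewSum t s) = k := by
  obtain rfl | hk := hk.eq_or_lt
  · obtain ⟨s, hs, hs'⟩ := exists_numNodes_hsFull_eq 1 m le_rfl (by omega)
    suffices h : ∀ n : ℕ, ∃ t : Shape, t.numNodes = n ∧ hsFull (skewSum t s) = 1 by
      obtain ⟨t, ht, ht'⟩ := h m
      exact ⟨t, s, ht, hs, ht'⟩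
    intro n
    induction n with
    | zero => exact ⟨.nil, by simp, by simpa [skewSum] using hs'⟩
    | succ n ih =>
      obtain ⟨t, ht, ht'⟩ := ih
      exact ⟨.node () t .nil, by simp [ht], by simp [skewSum, hsFull, ht']⟩
  · obtain ⟨j, rfl⟩ : ∃ j, k = j + 1 := ⟨k - 1, by omega⟩
    rw [pow_succ] at hkm
    obtain ⟨l, hl, hl'⟩ := exists_numNodes_hsFull_eq j (m - 1) (by omega) (by omega)
    obtain ⟨s, hs, hs'⟩ := exists_numNodes_hsFull_eq j m (by omega) (by omega)
    exact ⟨.node () .nil l, s, by simp only [numNodes]; omega, hs,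
      by simp [skewSum, hsFull, hl', hs']⟩

/-! ### Generating functions truncated by height -/

/-- The finite set of binary tree shapes of height at most `d`. -/
def treesOfHeightLE : ℕ → Finset Shape
  | 0 => {.nil}
  | d + 1 => insert .nil ((treesOfHeightLE d ×ˢ treesOfHeightLE d).image fun p => .node () p.1 p.2)

theorem mem_treesOfHeightLE {t : Shape} {d : ℕ} (h : t.height ≤ d) : t ∈ treesOfHeightLE d := by
  induction t generalizing d with
  | nil => cases d <;> simp [treesOfHeightLE]
  | node a l r ihl ihr =>
    cases d with
    | zero => simp at h
    | succ d =>
      simp only [height, Nat.add_le_add_iff_right, max_le_iff] at h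
      simp [treesOfHeightLE, ihl h.1, ihr h.2]

theorem sum_treesOfHeightLE_succ (f : Shape → ℝ) (d : ℕ) :
    ∑ t ∈ treesOfHeightLE (d + 1), f t =
      f .nil + ∑ l ∈ treesOfHeightLE d, ∑ r ∈ treesOfHeightLE d, f (.node () l r) := by
  rw [treesOfHeightLE, Finset.sum_insert (by simp), Finset.sum_image, Finset.sum_product]
  rintro ⟨a, b⟩ _ ⟨c, d⟩ _ h
  simpa using h

/-- The weight `z ^ |t|` of a tree with Horton–Strahler number `k`, and `0` for other trees. -/
noncomputable def weight (z : ℝ) (k : ℕ) (t : Shape) : ℝ :=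
  if hsFull t = k then z ^ t.numNodes else 0

theorem weight_nonneg {z : ℝ} (hz : 0 ≤ z) (k : ℕ) (t : Shape) : 0 ≤ weight z k t := by
  unfold weight; split_ifs <;> positivity

theorem sum_range_weight (z : ℝ) (k : ℕ) (t : Shape) :
    ∑ j ∈ Finset.range k, weight z j t = if hsFull t < k then z ^ t.numNodes else 0 := by
  simp [weight, Finset.sum_ite_eq]

/-- Number `k + 1` arises from two children with number `k`, or from one child with number `k + 1`
and a smaller sibling. -/
theorem weight_succ_node (z : ℝ) (k : ℕ) (l r : Shape) :
    weight z (k + 1) (.node () l r) = z * (weight z k l * weight z k r +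
      weight z (k + 1) l * ∑ j ∈ Finset.range (k + 1), weight z j r +
      (∑ j ∈ Finset.range (k + 1), weight z j l) * weight z (k + 1) r) := by
  have hp : z ^ (l.numNodes + r.numNodes + 1) = z * (z ^ l.numNodes * z ^ r.numNodes) := by ring
  rw [sum_range_weight, sum_range_weight]
  simp only [weight, hsFull, numNodes, hp]
  generalize z ^ l.numNodes = x
  generalize z ^ r.numNodes = y
  generalize hsFull l = a
  generalize hsFull r = b
  split_ifs <;> first | omega | simp

theorem sum_weight_succ (z : ℝ) (k d : ℕ) :
    ∑ t ∈ treesOfHeightLE (d + 1), weight z (k + 1) t =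
      z * ((∑ t ∈ treesOfHeightLE d, weight z k t) ^ 2 +
        2 * (∑ t ∈ treesOfHeightLE d, weight z (k + 1) t) *
          ∑ j ∈ Finset.range (k + 1), ∑ t ∈ treesOfHeightLE d, weight z j t) := by
  rw [sum_treesOfHeightLE_succ, Finset.sum_comm (s := Finset.range (k + 1))]
  simp only [weight_succ_node, ← Finset.mul_sum, Finset.sum_add_distrib, ← Finset.sum_mul]
  rw [weight, hsFull, if_neg (by omega)]
  ring

/-- A supersolution of the recursion satisfied by the generating functions of the trees with given
Horton–Strahler number dominates these generating functions. -/
theorem sum_weight_le {z : ℝ} (hz : 0 ≤ z) {r : ℕ → ℝ} {K : ℕ} (hr : r 0 = 1)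
    (hrec : ∀ k < K, z * (r k ^ 2 + 2 * r (k + 1) * ∑ j ∈ Finset.range (k + 1), r j) ≤ r (k + 1))
    (hr0 : ∀ k ≤ K, 0 ≤ r k) (d : ℕ) :
    ∀ k ≤ K, ∑ t ∈ treesOfHeightLE d, weight z k t ≤ r k := by
  -- Truncation by height keeps the sums finite, so `z > 1/4` is allowed; the bound passes from
  -- height `d` to `d + 1` because the recursion is monotone in its nonnegative arguments.
  induction d with
  | zero =>
    intro k hk
    rcases k with _ | k
    · simp [treesOfHeightLE, weight, hsFull, hr]
    · simpa [treesOfHeightLE, weight, hsFull] using hr0 _ hk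
  | succ d ih =>
    intro k hk
    rcases k with _ | k
    · rw [sum_treesOfHeightLE_succ, hr]
      have h (l s : Shape) : weight z 0 (.node () l s) = 0 := by
        have := one_le_hsFull (t := .node () l s) (by simp)
        rw [weight, if_neg (by omega)]
      simp [h]
      simp [weight, hsFull]
    · rw [sum_weight_succ]
      refine le_trans ?_ (hrec k hk)
      have hn (j : ℕ) : 0 ≤ ∑ t ∈ treesOfHeightLE d, weight z j t :=
        Finset.sum_nonneg fun t _ => weight_nonneg hz j t
      have hk0 := hr0 _ hk
      have h1 := ih k (by omega)
      have h2 := ih (k + 1) hk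
      have h3 : ∑ j ∈ Finset.range (k + 1), ∑ t ∈ treesOfHeightLE d, weight z j t ≤
          ∑ j ∈ Finset.range (k + 1), r j :=
        Finset.sum_le_sum fun j hj => ih j (by rw [Finset.mem_range] at hj; omega)
      have h4 := Finset.sum_nonneg fun j (_ : j ∈ Finset.range (k + 1)) => hn j
      have := hn k
      gcongr

theorem height_le_numNodes (t : Shape) : t.height ≤ t.numNodes := by
  induction t with
  | nil => simp
  | node a l r ihl ihr => simp only [height, numNodes]; omega

theorem card_hsFull_eq_mul_pow_le {z : ℝ} (hz : 0 ≤ z) (n k : ℕ) :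
    ((treesOfNumNodesEq n).filter (hsFull · = k)).card * z ^ n ≤
      ∑ t ∈ treesOfHeightLE n, weight z k t := by
  calc _ = ∑ t ∈ (treesOfNumNodesEq n).filter (hsFull · = k), weight z k t := by
        rw [← nsmul_eq_mul, ← Finset.sum_const]
        refine Finset.sum_congr rfl fun t ht => ?_
        rw [Finset.mem_filter, mem_treesOfNumNodesEq] at ht
        rw [weight, if_pos ht.2, ht.1]
    _ ≤ _ := by
        refine Finset.sum_le_sum_of_subset_of_nonneg (fun t ht => ?_)
          fun t _ _ => weight_nonneg hz k t
        rw [Finset.mem_filter, mem_treesOfNumNodesEq] at ht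
        exact mem_treesOfHeightLE (ht.1 ▸ height_le_numNodes t)

theorem four_pow_le_card_treesOfNumNodesEq {n : ℕ} (hn : 0 < n) :
    (4 : ℝ) ^ n ≤ 2 * n * (n + 1) * (treesOfNumNodesEq n).card := by
  have h1 := Nat.four_pow_le_two_mul_self_mul_centralBinom n hn
  rw [← succ_mul_catalan_eq_centralBinom n, ← treesOfNumNodesEq_card_eq_catalan] at h1
  have h2 : ((4 ^ n : ℕ) : ℝ) ≤ _ := Nat.cast_le.mpr h1
  push_cast at h2
  linarith

/-! ### Tail bounds from sine and hyperbolic sine -/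

/-- The explicit solution of the recursion for generating functions by duplication formulas. -/
theorem duplication_solution {S C : ℕ → ℝ} {K : ℕ} (hC : C 0 ≠ 0)
    (hS : ∀ k ≤ K + 1, S k ≠ 0) (hSs : ∀ k ≤ K, S (k + 1) = 2 * S k * C k)
    (hCs : ∀ k ≤ K, C (k + 1) = 2 * C k ^ 2 - 1) :
    (∀ k ≤ K, ∑ j ∈ Finset.range (k + 1), S 1 / S (j + 1) =
      2 * C 0 ^ 2 - S 1 * C (k + 1) / S (k + 1)) ∧
    ∀ k < K, 1 / (4 * C 0 ^ 2) * ((S 1 / S (k + 1)) ^ 2 + 2 * (S 1 / S (k + 2)) *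
      ∑ j ∈ Finset.range (k + 1), S 1 / S (j + 1)) = S 1 / S (k + 2) := by
  -- This telescopes `1 / sin 2x = cot x - cot 2x`, starting from `S 1 * C 0 / S 0 = 2 * C 0 ^ 2`.
  have hsum : ∀ k ≤ K, ∑ j ∈ Finset.range (k + 1), S 1 / S (j + 1) =
      2 * C 0 ^ 2 - S 1 * C (k + 1) / S (k + 1) := by
    intro k
    induction k with
    | zero =>
      intro _
      have := hS 1 (by omega)
      simp only [zero_add, Finset.sum_range_one]
      rw [hCs 0 (by omega)]
      field_simp
      ring
    | succ k ih =>
      intro hk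
      rw [Finset.sum_range_succ, ih (by omega)]
      have h1 := hS (k + 1) (by omega)
      have h2 := hS (k + 2) (by omega)
      have h3 := hSs (k + 1) hk
      have h4 : C (k + 1) ≠ 0 := by
        intro h; rw [h, mul_zero] at h3; exact h2 h3
      rw [h3, hCs (k + 1) hk]
      field_simp
      ring
  refine ⟨hsum, fun k hk => ?_⟩
  rw [hsum k hk.le]
  have h1 := hS (k + 1) (by omega)
  have h2 := hS (k + 2) (by omega)
  have h3 := hSs (k + 1) hk
  have h4 : C (k + 1) ≠ 0 := by
    intro h; rw [h, mul_zero] at h3; exact h2 h3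
  rw [h3]
  field_simp
  ring

theorem card_filter_hsFull_le_eq_sum (n K : ℕ) :
    ((treesOfNumNodesEq n).filter (hsFull · ≤ K)).card =
      ∑ j ∈ Finset.range (K + 1), ((treesOfNumNodesEq n).filter (hsFull · = j)).card := by
  rw [Finset.card_eq_sum_card_fiberwise (f := hsFull) (t := Finset.range (K + 1))]
  · refine Finset.sum_congr rfl fun j hj => ?_
    rw [Finset.mem_range] at hj
    rw [Finset.filter_filter]
    congr 1
    exact Finset.filter_congr fun t _ => ⟨fun h => h.2, fun h => ⟨by omega, h⟩⟩
  · intro t ht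
    have := (Finset.mem_filter.1 ht).2
    simp only [Finset.coe_range, Set.mem_Iio]
    omega

/-- Bounds for the numbers of trees with given Horton–Strahler number from sequences that satisfy
the duplication formulas of sine and cosine. -/
theorem card_hsFull_le_of_duplication {S C : ℕ → ℝ} {K : ℕ} (hC : C 0 ≠ 0)
    (hS : ∀ k ≤ K + 1, 0 < S k) (hSs : ∀ k ≤ K, S (k + 1) = 2 * S k * C k)
    (hCs : ∀ k ≤ K, C (k + 1) = 2 * C k ^ 2 - 1) (n : ℕ) :
    (((treesOfNumNodesEq n).filter (hsFull · = K)).card : ℝ) ≤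
      S 1 / S (K + 1) * (4 ^ n * (C 0 ^ 2) ^ n) ∧
    (((treesOfNumNodesEq n).filter (hsFull · ≤ K)).card : ℝ) ≤
      (2 * C 0 ^ 2 - S 1 * C (K + 1) / S (K + 1)) * (4 ^ n * (C 0 ^ 2) ^ n) := by
  obtain ⟨hsum, hrec⟩ := duplication_solution hC (fun k hk => (hS k hk).ne') hSs hCs
  have hz : 0 ≤ 1 / (4 * C 0 ^ 2) := by positivity
  have hle : ∀ k ≤ K, (((treesOfNumNodesEq n).filter (hsFull · = k)).card : ℝ) *
      (1 / (4 * C 0 ^ 2)) ^ n ≤ S 1 / S (k + 1) := fun k hk =>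
    (card_hsFull_eq_mul_pow_le hz n k).trans
      (sum_weight_le hz (r := fun k => S 1 / S (k + 1)) (div_self (hS 1 (by omega)).ne')
        (fun k hk => (hrec k hk).le)
        (fun k hk => (div_pos (hS 1 (by omega)) (hS (k + 1) (by omega))).le) n k hk)
  have hzn : (1 / (4 * C 0 ^ 2)) ^ n = (4 ^ n * (C 0 ^ 2) ^ n)⁻¹ := by
    rw [one_div, inv_pow, mul_pow]
  have hpos : 0 < 4 ^ n * (C 0 ^ 2) ^ n := by positivity
  rw [hzn] at hle
  simp only [← div_eq_mul_inv] at hle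
  refine ⟨(div_le_iff₀ hpos).1 (hle K le_rfl), (div_le_iff₀ hpos).1 ?_⟩
  rw [card_filter_hsFull_le_eq_sum, Nat.cast_sum, Finset.sum_div, ← hsum K le_rfl]
  exact Finset.sum_le_sum fun k hk => hle k (by rw [Finset.mem_range] at hk; omega)

theorem card_hsFull_le_le (n K : ℕ) :
    (((treesOfNumNodesEq n).filter (hsFull · ≤ K)).card : ℝ) ≤
      2 * 4 ^ n * Real.exp (-(n / 4 ^ (K + 1))) := by
  -- The last angle `2^(K+1) θ` is then `π / 2`: all sines involved are positive and the subtracted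
  -- term is nonnegative.
  set θ : ℝ := Real.pi / 2 ^ (K + 2) with hθ
  have hθ0 : 0 < θ := by positivity
  have hlt {k : ℕ} (hk : k ≤ K + 1) : 2 ^ k * θ ≤ Real.pi / 2 := by
    have : (2 : ℝ) ^ k ≤ 2 ^ (K + 1) := pow_le_pow_right₀ (by norm_num) hk
    calc 2 ^ k * θ ≤ 2 ^ (K + 1) * θ := by gcongr
      _ = Real.pi / 2 := by rw [hθ]; field_simp; ring
  have hSpos (k : ℕ) (hk : k ≤ K + 1) : 0 < Real.sin (2 ^ k * θ) :=
    Real.sin_pos_of_pos_of_lt_pi (by positivity) (by linarith [hlt hk, Real.pi_pos])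
  have hθ2 : θ < Real.pi / 2 := by
    have := hlt (k := 1) (by omega)
    linarith
  have hCpos : 0 < Real.cos θ := Real.cos_pos_of_mem_Ioo ⟨by linarith, hθ2⟩
  have h2 := (card_hsFull_le_of_duplication (S := fun k => Real.sin (2 ^ k * θ))
    (C := fun k => Real.cos (2 ^ k * θ)) (K := K) (by simpa using hCpos.ne') hSpos
    (fun k _ => by rw [← Real.sin_two_mul]; ring_nf)
    (fun k _ => by rw [← Real.cos_two_mul]; ring_nf) n).2
  beta_reduce at h2
  rw [show (2 : ℝ) ^ 0 * θ = θ by ring] at h2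
  have h1 : 0 ≤ Real.sin (2 ^ 1 * θ) * Real.cos (2 ^ (K + 1) * θ) /
      Real.sin (2 ^ (K + 1) * θ) := by
    refine div_nonneg (mul_nonneg (hSpos 1 (by omega)).le
      (Real.cos_nonneg_of_mem_Icc ⟨?_, hlt le_rfl⟩)) (hSpos (K + 1) le_rfl).le
    have : 0 ≤ 2 ^ (K + 1) * θ := by positivity
    linarith [Real.pi_pos]
  replace h2 : _ ≤ 2 * (4 ^ n * (Real.cos θ ^ 2) ^ n) :=
    h2.trans (by gcongr; linarith [Real.cos_sq_le_one θ])
  refine h2.trans ?_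
  rw [← mul_assoc]
  gcongr
  -- Jordan's inequality `sin θ ≥ 2θ / π`.
  have hsin : 1 / 2 ^ (K + 1) ≤ Real.sin θ := by
    refine le_trans (le_of_eq ?_) (Real.mul_le_sin hθ0.le hθ2.le)
    rw [hθ]
    have := Real.pi_pos
    field_simp
    ring
  have hsq : 1 / 4 ^ (K + 1) ≤ Real.sin θ ^ 2 := by
    calc (1 : ℝ) / 4 ^ (K + 1) = (1 / 2 ^ (K + 1)) ^ 2 := by
          rw [div_pow, ← pow_mul, mul_comm, pow_mul]; norm_num
      _ ≤ _ := by gcongr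
  calc (Real.cos θ ^ 2) ^ n ≤ Real.exp (-(1 / 4 ^ (K + 1))) ^ n := by
        gcongr
        rw [Real.cos_sq']
        linarith [Real.add_one_le_exp (-(1 / 4 ^ (K + 1) : ℝ))]
    _ = _ := by rw [← Real.exp_nat_mul]; congr 1; ring

theorem card_hsFull_eq_le {n : ℕ} (hn : 0 < n) (k : ℕ) :
    (((treesOfNumNodesEq n).filter (hsFull · = k)).card : ℝ) ≤
      Real.exp 1 * Real.sinh 2 * 4 ^ n / Real.sinh (2 ^ k / √n) := by
  -- This scale keeps `(cosh θ)^(2n) ≤ exp (n θ²) = e` bounded.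
  set θ : ℝ := 1 / √n with hθ
  have hn' : (1 : ℝ) ≤ n := by exact_mod_cast hn
  have hn1 : 1 ≤ √(n : ℝ) := Real.one_le_sqrt.2 hn'
  have hθ0 : 0 < θ := by positivity
  have hθ1 : θ ≤ 1 := by rw [hθ, div_le_one (by positivity)]; exact hn1
  have hSpos (k : ℕ) : 0 < Real.sinh (2 ^ k * θ) := Real.sinh_pos_iff.2 (by positivity)
  have hle := (card_hsFull_le_of_duplication (S := fun k => Real.sinh (2 ^ k * θ))
    (C := fun k => Real.cosh (2 ^ k * θ)) (K := k) (Real.cosh_pos _).ne' (fun k _ => hSpos k)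
    (fun k _ => by rw [← Real.sinh_two_mul]; ring_nf)
    (fun k _ => by
      have := Real.cosh_two_mul (2 ^ k * θ)
      rw [Real.sinh_sq] at this
      rw [pow_succ, mul_right_comm, mul_comm, this]; ring) n).1
  beta_reduce at hle
  rw [show (2 : ℝ) ^ 0 * θ = θ by ring] at hle
  have hcosh : (Real.cosh θ ^ 2) ^ n ≤ Real.exp 1 := by
    calc (Real.cosh θ ^ 2) ^ n ≤ (Real.exp (θ ^ 2 / 2) ^ 2) ^ n := by
          gcongr
          exact Real.cosh_le_exp_half_sq θ
      _ = Real.exp 1 := by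
          rw [← pow_mul, ← Real.exp_nat_mul]
          congr 1
          rw [hθ, div_pow, Real.sq_sqrt (by positivity)]
          push_cast
          field_simp
  calc _ ≤ _ := hle
    _ ≤ Real.sinh 2 / Real.sinh (2 ^ k / √n) * (4 ^ n * Real.exp 1) := by
      have h0 : 0 < Real.sinh (2 ^ k / √n) := Real.sinh_pos_iff.2 (by positivity)
      have h2 : 0 < Real.sinh 2 := Real.sinh_pos_iff.2 (by positivity)
      gcongr
      · rw [Real.sinh_le_sinh]; linarith
      · rw [Real.sinh_le_sinh, pow_succ, hθ, ← mul_one_div]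
        have : 0 ≤ (2 : ℝ) ^ k * (1 / √n) := by positivity
        linarith
    _ = _ := by ring

theorem card_le_two_pow_hsFull_le {n : ℕ} (hn : 0 < n) {B : ℝ} (hB : 0 < B) :
    (((treesOfNumNodesEq n).filter (fun t => B * √n ≤ 2 ^ hsFull t)).card : ℝ) ≤
      (n + 1) * (Real.exp 1 * Real.sinh 2 * 4 ^ n / Real.sinh B) := by
  have : (0 : ℝ) < n := by exact_mod_cast hn
  have hsB : 0 < Real.sinh B := Real.sinh_pos_iff.2 hB
  have h2 : 0 < Real.sinh 2 := Real.sinh_pos_iff.2 (by positivity)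
  rw [Finset.card_eq_sum_card_fiberwise (f := hsFull) (t := Finset.range (n + 1))]
  · push_cast
    calc _ ≤ ∑ _k ∈ Finset.range (n + 1), Real.exp 1 * Real.sinh 2 * 4 ^ n / Real.sinh B := by
          refine Finset.sum_le_sum fun k _ => ?_
          by_cases hk : B * √n ≤ 2 ^ k
          · calc _ ≤ (((treesOfNumNodesEq n).filter (hsFull · = k)).card : ℝ) := by
                  gcongr
                  exact Finset.filter_subset _ _
              _ ≤ _ := card_hsFull_eq_le hn k
              _ ≤ _ := by
                  gcongr
                  rw [Real.sinh_le_sinh, le_div_iff₀ (by positivity)]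
                  exact hk
          · rw [Finset.filter_filter, Finset.filter_false_of_mem]
            · simp; positivity
            · rintro t - ⟨h, rfl⟩
              exact hk h
      _ = _ := by simp
  · intro t ht
    have ht := (Finset.mem_filter.1 ht).1
    rw [mem_treesOfNumNodesEq] at ht
    have := two_pow_hsFull_le t
    have := (hsFull t).lt_two_pow_self
    simp only [Finset.coe_range, Set.mem_Iio]
    omega

/-- The largest number attained under the constraint serves as `K` in `card_hsFull_le_le`. -/
theorem card_four_pow_hsFull_le_le (n : ℕ) {A : ℝ} :
    (((treesOfNumNodesEq n).filter (fun t => 4 ^ hsFull t ≤ A)).card : ℝ) ≤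
      2 * 4 ^ n * Real.exp (-(n / (4 * A))) := by
  rcases ((treesOfNumNodesEq n).filter (fun t => 4 ^ hsFull t ≤ A)).eq_empty_or_nonempty with h | h
  · rw [h]; simp; positivity
  · obtain ⟨s, hs, hmax⟩ := Finset.exists_max_image _ hsFull h
    have hs' : 4 ^ hsFull s ≤ A := (Finset.mem_filter.1 hs).2
    calc _ ≤ (((treesOfNumNodesEq n).filter (hsFull · ≤ hsFull s)).card : ℝ) := by
          gcongr with t ht
          exact fun h' => hmax t (Finset.mem_filter.2 ⟨ht, h'⟩)
      _ ≤ _ := card_hsFull_le_le n _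
      _ ≤ _ := by
        rw [pow_succ']
        gcongr

/-! ### Concentration for one uniform tree -/

theorem tendsto_pow_mul_exp_neg_rpow (p : ℕ) {b c : ℝ} (hb : 0 < b) (hc : 0 < c) :
    Tendsto (fun n : ℕ => (n : ℝ) ^ p * Real.exp (-(c * (n : ℝ) ^ b))) atTop (𝓝 0) := by
  have h := (tendsto_rpow_mul_exp_neg_mul_atTop_nhds_zero (p / b) c hc).comp
    ((tendsto_rpow_atTop hb).comp tendsto_natCast_atTop_atTop)
  refine h.congr fun n => ?_
  simp only [Function.comp_apply]
  rw [← Real.rpow_mul (Nat.cast_nonneg n), mul_div_cancel₀ _ hb.ne', Real.rpow_natCast, neg_mul]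

theorem deviation_card_ratio_le {δ : ℝ} (hδ : 0 < δ) {n : ℕ} (hn : 2 ≤ n) :
    (((treesOfNumNodesEq n).filter
      (fun t => δ * Real.logb 4 n ≤ |(hsFull t : ℝ) - Real.logb 4 n|)).card : ℝ) /
        (treesOfNumNodesEq n).card ≤
      32 * (Real.exp 1 * Real.sinh 2) * (n ^ 3 * Real.exp (-(1 * (n : ℝ) ^ (δ / 2)))) +
        8 * (n ^ 2 * Real.exp (-(1 / 4 * (n : ℝ) ^ δ))) := by
  have hn1 : (1 : ℝ) ≤ n := by exact_mod_cast (by omega : 1 ≤ n)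
  have hn0 : (0 : ℝ) < n := by linarith
  have h2 : 0 < Real.sinh 2 := Real.sinh_pos_iff.2 (by positivity)
  have hB1 : 1 ≤ (n : ℝ) ^ (δ / 2) := Real.one_le_rpow hn1 (by positivity)
  have hsinh : Real.exp ((n : ℝ) ^ (δ / 2)) / 4 ≤ Real.sinh ((n : ℝ) ^ (δ / 2)) := by
    rw [Real.sinh_eq]
    have h1 := Real.add_one_le_exp ((n : ℝ) ^ (δ / 2))
    have h3 : Real.exp (-(n : ℝ) ^ (δ / 2)) ≤ 1 := Real.exp_le_one_iff.2 (by linarith)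
    linarith
  have hlog (x : ℝ) : (4 : ℝ) ^ (x * Real.logb 4 n) = (n : ℝ) ^ x := by
    rw [mul_comm, Real.rpow_mul (by norm_num), Real.rpow_logb (by norm_num) (by norm_num) hn0]
  -- With `L = log₄ n`, number at least `(1 + δ) L` means `2^hsFull ≥ n^(δ/2) √n`, and at most `(1 -
  -- δ) L` means `4^hsFull ≤ n^(1-δ)`.
  have hcard : (((treesOfNumNodesEq n).filter
      (fun t => δ * Real.logb 4 n ≤ |(hsFull t : ℝ) - Real.logb 4 n|)).card : ℝ) ≤
      (n + 1) * (Real.exp 1 * Real.sinh 2 * 4 ^ n / Real.sinh ((n : ℝ) ^ (δ / 2))) +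
        2 * 4 ^ n * Real.exp (-(n / (4 * (n : ℝ) ^ (1 - δ)))) := by
    refine le_trans ?_ (add_le_add
      (card_le_two_pow_hsFull_le (n := n) (by omega) (by positivity))
      (card_four_pow_hsFull_le_le n))
    norm_cast
    refine le_trans (Finset.card_le_card fun t ht => ?_) (Finset.card_union_le _ _)
    rw [Finset.mem_union, Finset.mem_filter, Finset.mem_filter]
    rw [Finset.mem_filter] at ht
    refine (le_abs.1 ht.2).imp (fun h => ⟨ht.1, ?_⟩) (fun h => ⟨ht.1, ?_⟩)
    · rw [Real.sqrt_eq_rpow, ← Real.rpow_add hn0, ← hlog]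
      calc (4 : ℝ) ^ ((δ / 2 + 1 / 2) * Real.logb 4 n) ≤ 4 ^ ((hsFull t : ℝ) / 2) := by
            gcongr
            · norm_num
            · linarith
        _ = _ := by
            rw [show (4 : ℝ) = 2 ^ (2 : ℝ) by norm_num, ← Real.rpow_mul (by norm_num),
              mul_div_cancel₀ _ two_ne_zero, Real.rpow_natCast]
            norm_num
    · rw [← hlog]
      push_cast
      rw [← Real.rpow_natCast]
      gcongr
      · norm_num
      · linarith
  have htot := four_pow_le_card_treesOfNumNodesEq (n := n) (by omega)
  have hpos : (0 : ℝ) < (treesOfNumNodesEq n).card := by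
    have : (0 : ℝ) < 4 ^ n := by positivity
    by_contra h
    have : ((treesOfNumNodesEq n).card : ℝ) = 0 := le_antisymm (not_lt.1 h) (Nat.cast_nonneg _)
    rw [this] at htot
    linarith
  rw [div_le_iff₀ hpos]
  have hA : (n : ℝ) / (4 * (n : ℝ) ^ (1 - δ)) = 1 / 4 * (n : ℝ) ^ δ := by
    rw [Real.rpow_sub hn0, Real.rpow_one]
    field_simp
  rw [hA] at hcard
  have hE : (1 : ℝ) / Real.sinh ((n : ℝ) ^ (δ / 2)) ≤ 4 * Real.exp (-(1 * (n : ℝ) ^ (δ / 2))) := by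
    have := Real.exp_pos ((n : ℝ) ^ (δ / 2))
    rw [one_mul, Real.exp_neg, ← div_eq_mul_inv, div_le_div_iff₀ (by linarith) this]
    linarith
  set E := Real.exp (-(1 * (n : ℝ) ^ (δ / 2)))
  set F := Real.exp (-(1 / 4 * (n : ℝ) ^ δ))
  set c := Real.exp 1 * Real.sinh 2
  set N : ℝ := ((treesOfNumNodesEq n).card : ℝ)
  have hc : 0 ≤ c := by positivity
  have hE0 : 0 ≤ E := (Real.exp_pos _).le
  have hF0 : 0 ≤ F := (Real.exp_pos _).le
  have h4 : (4 : ℝ) ^ n ≤ 4 * n ^ 2 * N := by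
    refine htot.trans ?_
    have : 2 * (n : ℝ) * (n + 1) ≤ 4 * n ^ 2 := by nlinarith
    gcongr
  calc _ ≤ _ := hcard
    _ = ((n + 1) * c * (1 / Real.sinh ((n : ℝ) ^ (δ / 2))) + 2 * F) * 4 ^ n := by ring
    _ ≤ ((2 * n) * c * (4 * E) + 2 * F) * (4 * n ^ 2 * N) := by
      gcongr
      linarith
    _ = _ := by ring

theorem uniformOn_numNodes_apply (n : ℕ) (p : Shape → Prop) [DecidablePred p] :
    uniformOn {t : Shape | t.numNodes = n} {t | p t} =
      ENNReal.ofReal ((((treesOfNumNodesEq n).filter p).card : ℝ) / (treesOfNumNodesEq n).card) := by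
  rw [← coe_treesOfNumNodesEq, ← uniformOn_inter_self (Finset.finite_toSet _),
    ← Set.sep_mem_eq, show {t | t ∈ (treesOfNumNodesEq n : Set Shape) ∧ t ∈ {t | p t}} =
      (((treesOfNumNodesEq n).filter p : Finset Shape) : Set Shape) by ext; simp,
    uniformOn_apply_finset, Finset.inter_eq_right.2 (Finset.filter_subset _ _),
    ENNReal.ofReal_div_of_pos, ENNReal.ofReal_natCast, ENNReal.ofReal_natCast]
  rcases n with _ | n
  · simp
  · have h := four_pow_le_card_treesOfNumNodesEq n.succ_pos
    by_contra h'
    have h0 : ((treesOfNumNodesEq (n + 1)).card : ℝ) = 0 :=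
      le_antisymm (not_lt.1 h') (Nat.cast_nonneg _)
    rw [h0, mul_zero] at h
    exact absurd h (not_le.2 (by positivity))

/-- The Horton–Strahler number of a uniform binary tree with `n` nodes concentrates
around `log₄ n`. -/
theorem tendsto_uniformOn_deviation {δ : ℝ} (hδ : 0 < δ) :
    Tendsto (fun n : ℕ => uniformOn {t : Shape | t.numNodes = n}
      {t | δ * Real.logb 4 n ≤ |(hsFull t : ℝ) - Real.logb 4 n|}) atTop (𝓝 0) := by
  have h := ((tendsto_pow_mul_exp_neg_rpow 3 (half_pos hδ) one_pos).const_mul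
    (32 * (Real.exp 1 * Real.sinh 2))).add
      ((tendsto_pow_mul_exp_neg_rpow 2 hδ (by norm_num : (0 : ℝ) < 1 / 4)).const_mul 8)
  rw [mul_zero, mul_zero, add_zero] at h
  have h' := ENNReal.tendsto_ofReal h
  rw [ENNReal.ofReal_zero] at h'
  refine tendsto_of_tendsto_of_tendsto_of_le_of_le' tendsto_const_nhds h'
    (Eventually.of_forall fun _ => zero_le) ?_
  filter_upwards [eventually_ge_atTop 2] with n hn
  classical
  rw [uniformOn_numNodes_apply]
  exact ENNReal.ofReal_le_ofReal (by convert deviation_card_ratio_le hδ hn)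

/-! ### Supports -/

theorem finite_numNodes_eq (n : ℕ) : {t : Shape | t.numNodes = n}.Finite := by
  rw [← coe_treesOfNumNodesEq]
  exact Finset.finite_toSet _

theorem IsEBT.measure_pos_iff {Ω : Type*} [MeasurableSpace Ω] {P : Measure Ω} {n : ℕ}
    {T : Ω → Shape} (hT : IsEBT P n T) (p : Shape → Prop) :
    0 < P {ω | p (T ω)} ↔ ∃ t : Shape, t.numNodes = n ∧ p t := by
  rw [HasLaw.measure_eq hT (.of_discrete), pos_iff_ne_zero, ne_eq,
    uniformOn_eq_zero_iff (finite_numNodes_eq n), ← ne_eq, ← Set.nonempty_iff_ne_empty]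
  rfl

theorem IsEBT.ae_numNodes_eq {Ω : Type*} [MeasurableSpace Ω] {P : Measure Ω} {n : ℕ}
    {T : Ω → Shape} (hT : IsEBT P n T) : ∀ᵐ ω ∂P, (T ω).numNodes = n := by
  rw [ae_iff, ← nonpos_iff_eq_zero, ← not_lt, hT.measure_pos_iff (fun t => ¬ t.numNodes = n)]
  rintro ⟨t, h, h'⟩
  exact h' h

theorem IsEBT.valueSupport_eq {Ω : Type*} [MeasurableSpace Ω] {P : Measure Ω} {n : ℕ}
    {T : Ω → Shape} (hT : IsEBT P n T) (f : Shape → ℕ) :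
    valueSupport P (fun ω => f (T ω)) = f '' {t | t.numNodes = n} := by
  ext k
  exact hT.measure_pos_iff (f · = k)

theorem IsEBT.valueSupport_pair_eq {Ω : Type*} [MeasurableSpace Ω] {P : Measure Ω} {m : ℕ}
    {T₁ T₂ : Ω → Shape} (hT₁ : IsEBT P m T₁) (hT₂ : IsEBT P m T₂) (hind : IndepFun T₁ T₂ P)
    (glue : Shape → Shape → Shape) (f : Shape → ℕ) :
    valueSupport P (fun ω => f (glue (T₁ ω) (T₂ ω))) =
      f '' {u | ∃ t s : Shape, t.numNodes = m ∧ s.numNodes = m ∧ glue t s = u} := by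
  ext k
  constructor
  · intro hk
    have hk' : ∃ᵐ ω ∂P, f (glue (T₁ ω) (T₂ ω)) = k :=
      frequently_ae_iff.2 (pos_iff_ne_zero.1 hk)
    obtain ⟨ω, hω, h₁, h₂⟩ :=
      (hk'.and_eventually (hT₁.ae_numNodes_eq.and hT₂.ae_numNodes_eq)).exists
    exact ⟨_, ⟨_, _, h₁, h₂, rfl⟩, hω⟩
  · rintro ⟨_, ⟨t, s, ht, hs, rfl⟩, hk⟩
    have h := hind.measure_inter_preimage_eq_mul {t} {s} (.of_discrete) (.of_discrete)
    refine lt_of_lt_of_le (b := P (T₁ ⁻¹' {t} ∩ T₂ ⁻¹' {s})) ?_ (measure_mono ?_)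
    · rw [h]
      exact ENNReal.mul_pos ((hT₁.measure_pos_iff (· = t)).2 ⟨t, ht, rfl⟩).ne'
        ((hT₂.measure_pos_iff (· = s)).2 ⟨s, hs, rfl⟩).ne'
    · rintro ω ⟨h₁, h₂⟩
      rw [Set.mem_preimage, Set.mem_singleton_iff] at h₁ h₂
      change f (glue (T₁ ω) (T₂ ω)) = k
      rw [h₁, h₂, hk]

theorem le_floor_logb_iff (k m : ℕ) :
    k ≤ ⌊Real.logb 2 (2 * m + 1)⌋₊ ↔ 2 ^ k ≤ 2 * m + 1 := by
  rw [Nat.le_floor_iff (Real.logb_nonneg (by norm_num) (by linarith [m.cast_nonneg (α := ℝ)])),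
    Real.le_logb_iff_rpow_le (by norm_num) (by positivity), Real.rpow_natCast]
  exact_mod_cast Iff.rfl

theorem hsFull_image_eq {m : ℕ} (hm : 1 ≤ m) {A : Set Shape}
    (hA : ∀ t ∈ A, t.numNodes = 2 * m)
    (hA' : ∀ k, 1 ≤ k → 2 ^ k ≤ 2 * m + 1 → ∃ t ∈ A, hsFull t = k) :
    hsFull '' A = Set.Icc 1 ⌊Real.logb 2 (2 * m + 1)⌋₊ := by
  ext k
  rw [Set.mem_Icc, le_floor_logb_iff]
  constructor
  · rintro ⟨t, ht, rfl⟩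
    have h := hA t ht
    exact ⟨one_le_hsFull (ne_nil_of_numNodes_pos (by omega)), h ▸ two_pow_hsFull_le t⟩
  · exact fun h => hA' k h.1 h.2

theorem hs_image_eq {m : ℕ} (hm : 1 ≤ m) {A : Set Shape}
    (hA : ∀ t ∈ A, t.numNodes = 2 * m)
    (hA' : ∀ k, 1 ≤ k → 2 ^ k ≤ 2 * m + 1 → ∃ t ∈ A, hsFull t = k) :
    hs '' A = Set.Icc 0 (⌊Real.logb 2 (2 * m + 1)⌋₊ - 1) := by
  -- Ensures that the natural subtraction in the upper endpoint is not truncated.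
  have h1 : 1 ≤ ⌊Real.logb 2 (2 * m + 1)⌋₊ := (le_floor_logb_iff 1 m).2 (by omega)
  have hne : ∀ t ∈ A, hsFull t = hs t + 1 := fun t ht =>
    hsFull_eq_hs_add_one (ne_nil_of_numNodes_pos (by rw [hA t ht]; omega))
  have hfull := hsFull_image_eq hm hA hA'
  ext k
  have hk : k ∈ hs '' A ↔ k + 1 ∈ hsFull '' A := by
    refine exists_congr fun t => and_congr_right fun ht => ?_
    rw [hne t ht, Nat.add_right_cancel_iff]
  rw [hk, hfull, Set.mem_Icc, Set.mem_Icc]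
  omega

/-! ### Transfer of the weak law -/

theorem abs_hs_sub_hsFull_le (t : Shape) : |(hs t : ℝ) - hsFull t| ≤ 1 := by
  rcases eq_or_ne t .nil with rfl | h
  · simp [hs, hsFull]
  · simp [hsFull_eq_hs_add_one h]

theorem exists_abs_hsFull_sub_le {t s u : Shape} (h : max (hsFull t) (hsFull s) ≤ hsFull u)
    (h' : hsFull u ≤ max (hsFull t) (hsFull s) + 1) :
    |(hsFull u : ℝ) - hsFull t| ≤ 1 ∨ |(hsFull u : ℝ) - hsFull s| ≤ 1 := by
  have key {a b : ℕ} (hab : b ≤ a) (hba : a ≤ b + 1) : |(a : ℝ) - b| ≤ 1 := by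
    have h1 : (b : ℝ) ≤ a := by exact_mod_cast hab
    have h2 : (a : ℝ) ≤ b + 1 := by exact_mod_cast hba
    rw [abs_le]; constructor <;> linarith
  rcases max_choice (hsFull t) (hsFull s) with h₀ | h₀ <;> rw [h₀] at h h'
  · exact .inl (key h h')
  · exact .inr (key h h')

/-- A quantity that stays within bounded distance of the Horton–Strahler number of one of two
uniform binary trees obeys the same weak law of large numbers. -/
theorem tendstoInProb_of_abs_sub_hsFull_le {Ω : ℕ → Type*} [∀ m, MeasurableSpace (Ω m)]
    (P : ∀ m, Measure (Ω m)) {T₁ T₂ : ∀ m, Ω m → Shape} {a : ℕ → ℕ}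
    (ha : Tendsto a atTop atTop)
    (ha' : ∀ m : ℕ, 1 ≤ m → |Real.logb 4 (a m) - Real.logb 4 (2 * m)| ≤ 1)
    (hT₁ : ∀ m, IsEBT (P m) (a m) (T₁ m)) (hT₂ : ∀ m, IsEBT (P m) (a m) (T₂ m))
    {X : ∀ m, Ω m → ℕ}
    (hX : ∀ m ω, |(X m ω : ℝ) - hsFull (T₁ m ω)| ≤ 2 ∨ |(X m ω : ℝ) - hsFull (T₂ m ω)| ≤ 2) :
    TendstoInProb P (fun m ω => (X m ω : ℝ) / Real.logb 4 (2 * m)) 1 := by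
  intro ε hε
  have hlim := (tendsto_uniformOn_deviation (half_pos hε)).comp ha
  have hlim2 := hlim.add hlim
  rw [add_zero] at hlim2
  have hL : Tendsto (fun m : ℕ => Real.logb 4 (2 * m)) atTop atTop :=
    (Real.tendsto_logb_atTop (by norm_num)).comp
      (tendsto_natCast_atTop_atTop.const_mul_atTop (by norm_num))
  refine tendsto_of_tendsto_of_tendsto_of_le_of_le' tendsto_const_nhds hlim2
    (Eventually.of_forall fun _ => zero_le) ?_
  -- The threshold is what `ε L - 3 ≥ (ε / 2) (L + 1)` requires; the 3 is the error 2 in `hX` plus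
  -- the error 1 in `ha'`.
  filter_upwards [eventually_ge_atTop 1, hL.eventually_ge_atTop (1 + 6 / ε)] with m hm hLm
  set L := Real.logb 4 (2 * m)
  set l := Real.logb 4 (a m)
  have hLpos : 0 < L := lt_of_lt_of_le (by positivity) hLm
  have hεL : ε + 6 ≤ ε * L := by
    calc ε + 6 = ε * (1 + 6 / ε) := by field_simp
      _ ≤ _ := by gcongr
  have hlL := abs_le.1 (ha' m hm)
  have key {x h : ℝ} (hx : ε ≤ |x / L - 1|) (hxh : |x - h| ≤ 2) : ε / 2 * l ≤ |h - l| := by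
    have h1 : ε * L ≤ |x - L| := by
      rw [div_sub_one hLpos.ne', abs_div, abs_of_pos hLpos, le_div_iff₀ hLpos] at hx
      exact hx
    have h2 : |x - L| ≤ |x - h| + |h - l| + |l - L| := by
      calc |x - L| = |(x - h) + (h - l) + (l - L)| := by ring_nf
        _ ≤ _ := abs_add_three _ _ _
    have h3 : |l - L| ≤ 1 := abs_le.2 hlL
    have h4 : ε * l ≤ ε * (L + 1) := by gcongr; linarith
    linarith
  have hlaw {T : Ω m → Shape} (hT : IsEBT (P m) (a m) T) :
      P m {ω | ε / 2 * l ≤ |(hsFull (T ω) : ℝ) - l|} =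
        uniformOn {t : Shape | t.numNodes = a m} {t | ε / 2 * l ≤ |(hsFull t : ℝ) - l|} :=
    HasLaw.measure_eq hT (p := fun t => ε / 2 * l ≤ |(hsFull t : ℝ) - l|) (.of_discrete)
  simp only [Function.comp_apply]
  nth_rewrite 1 [← hlaw (hT₁ m)]
  rw [← hlaw (hT₂ m)]
  -- Union bound over which of the two trees `X` is close to.
  refine (measure_mono fun ω hω => ?_).trans (measure_union_le _ _)
  exact (hX m ω).imp (key hω) (key hω)

end BlockTree

theorem theorem1 {Ω Ω' : ℕ → Type*}
    [∀ m, MeasurableSpace (Ω m)] [∀ m, MeasurableSpace (Ω' m)]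
    (P : ∀ m, Measure (Ω m)) [∀ m, IsProbabilityMeasure (P m)]
    (Q : ∀ m, Measure (Ω' m)) [∀ m, IsProbabilityMeasure (Q m)]
    (T₁ T₂ : ∀ m, Ω m → BlockTree.Shape) (U : ∀ m, Ω' m → BlockTree.Shape)
    (hT₁ : ∀ m, BlockTree.IsEBT (P m) m (T₁ m))
    (hT₂ : ∀ m, BlockTree.IsEBT (P m) m (T₂ m))
    (hind : ∀ m, IndepFun (T₁ m) (T₂ m) (P m))
    (hU : ∀ m, BlockTree.IsEBT (Q m) (2 * m) (U m)) :
    -- EBTs with `2 m` nodes: first order scaling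
    (BlockTree.TendstoInProb Q
        (fun m ω => (BlockTree.hs (U m ω) : ℝ) / Real.logb 4 (2 * m)) 1 ∧
      BlockTree.TendstoInProb Q
        (fun m ω => (BlockTree.hsFull (U m ω) : ℝ) / Real.logb 4 (2 * m)) 1) ∧
    -- merged trees, for both gluing operators
    ∀ glue : BlockTree.Shape → BlockTree.Shape → BlockTree.Shape,
      glue = BlockTree.directSum ∨ glue = BlockTree.skewSum →
      -- same support as for EBTs with `2 m` nodes, with its explicit value
      (∀ m : ℕ, 1 ≤ m →
        (BlockTree.valueSupport (P m) (fun ω => BlockTree.hs (glue (T₁ m ω) (T₂ m ω))) =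
            BlockTree.valueSupport (Q m) (fun ω => BlockTree.hs (U m ω)) ∧
          BlockTree.valueSupport (P m) (fun ω => BlockTree.hs (glue (T₁ m ω) (T₂ m ω))) =
            Set.Icc 0 (⌊Real.logb 2 (2 * m + 1)⌋₊ - 1)) ∧
        (BlockTree.valueSupport (P m) (fun ω => BlockTree.hsFull (glue (T₁ m ω) (T₂ m ω))) =
            BlockTree.valueSupport (Q m) (fun ω => BlockTree.hsFull (U m ω)) ∧
          BlockTree.valueSupport (P m) (fun ω => BlockTree.hsFull (glue (T₁ m ω) (T₂ m ω))) =
            Set.Icc 1 ⌊Real.logb 2 (2 * m + 1)⌋₊)) ∧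
      -- weak law of large numbers
      BlockTree.TendstoInProb P
        (fun m ω => (BlockTree.hs (glue (T₁ m ω) (T₂ m ω)) : ℝ) / Real.logb 4 (2 * m)) 1 ∧
      BlockTree.TendstoInProb P
        (fun m ω => (BlockTree.hsFull (glue (T₁ m ω) (T₂ m ω)) : ℝ) / Real.logb 4 (2 * m)) 1 := by
  open BlockTree in
  have hnear {t s u : Shape} (h : max (hsFull t) (hsFull s) ≤ hsFull u)
      (h' : hsFull u ≤ max (hsFull t) (hsFull s) + 1) :
      (|(hs u : ℝ) - hsFull t| ≤ 2 ∨ |(hs u : ℝ) - hsFull s| ≤ 2) ∧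
        (|(hsFull u : ℝ) - hsFull t| ≤ 2 ∨ |(hsFull u : ℝ) - hsFull s| ≤ 2) := by
    have h₁ := exists_abs_hsFull_sub_le h h'
    refine ⟨h₁.imp (fun h => ?_) (fun h => ?_), h₁.imp (fun h => ?_) (fun h => ?_)⟩
    · linarith [abs_sub_le (hs u : ℝ) (hsFull u) (hsFull t), abs_hs_sub_hsFull_le u]
    · linarith [abs_sub_le (hs u : ℝ) (hsFull u) (hsFull s), abs_hs_sub_hsFull_le u]
    · linarith
    · linarith
  have htwo : Tendsto (fun m : ℕ => 2 * m) atTop atTop :=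
    tendsto_id.const_mul_atTop' (by norm_num)
  have hlog (m : ℕ) (_ : 1 ≤ m) : |Real.logb 4 ((2 * m : ℕ) : ℝ) - Real.logb 4 (2 * m)| ≤ 1 := by
    simp
  have hlog' (m : ℕ) (hm : 1 ≤ m) : |Real.logb 4 (m : ℝ) - Real.logb 4 (2 * m)| ≤ 1 := by
    have hm' : (m : ℝ) ≠ 0 := by positivity
    rw [Real.logb_mul two_ne_zero hm', sub_add_cancel_right, abs_neg,
      abs_of_nonneg (Real.logb_nonneg (by norm_num) (by norm_num)),
      Real.logb_le_iff_le_rpow (by norm_num) (by norm_num)]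
    norm_num
  refine ⟨⟨?_, ?_⟩, fun glue hglue => ?_⟩
  -- `U` plays both trees as well as the merged one.
  · exact BlockTree.tendstoInProb_of_abs_sub_hsFull_le Q htwo hlog hU hU
      fun m ω => (hnear (max_self _).le (by simp)).1
  · exact BlockTree.tendstoInProb_of_abs_sub_hsFull_le Q htwo hlog hU hU
      fun m ω => (hnear (max_self _).le (by simp)).2
  have hsize (t s : BlockTree.Shape) : (glue t s).numNodes = t.numNodes + s.numNodes := by
    rcases hglue with rfl | rfl
    · exact BlockTree.numNodes_directSum t s
    · exact BlockTree.numNodes_skewSum t s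
  have hge (t s : BlockTree.Shape) :
      max (BlockTree.hsFull t) (BlockTree.hsFull s) ≤ BlockTree.hsFull (glue t s) := by
    rcases hglue with rfl | rfl
    · exact BlockTree.max_le_hsFull_directSum t s
    · exact BlockTree.max_le_hsFull_skewSum t s
  have hle (t s : BlockTree.Shape) :
      BlockTree.hsFull (glue t s) ≤ max (BlockTree.hsFull t) (BlockTree.hsFull s) + 1 := by
    rcases hglue with rfl | rfl
    · exact BlockTree.hsFull_directSum_le t s
    · exact BlockTree.hsFull_skewSum_le t s
  refine ⟨fun m hm => ?_, ?_, ?_⟩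
  · have hA : ∀ u ∈ {u | ∃ t s : BlockTree.Shape, t.numNodes = m ∧ s.numNodes = m ∧ glue t s = u},
        u.numNodes = 2 * m := by
      rintro _ ⟨t, s, ht, hs, rfl⟩
      rw [hsize, ht, hs, two_mul]
    have hA' : ∀ k, 1 ≤ k → 2 ^ k ≤ 2 * m + 1 →
        ∃ u ∈ {u | ∃ t s : BlockTree.Shape, t.numNodes = m ∧ s.numNodes = m ∧ glue t s = u},
          BlockTree.hsFull u = k := by
      intro k hk hkm
      obtain ⟨t, s, ht, hs, h⟩ : ∃ t s : BlockTree.Shape, t.numNodes = m ∧ s.numNodes = m ∧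
          BlockTree.hsFull (glue t s) = k := by
        rcases hglue with rfl | rfl
        · exact BlockTree.exists_hsFull_directSum_eq hm hk hkm
        · exact BlockTree.exists_hsFull_skewSum_eq hm hk hkm
      exact ⟨_, ⟨t, s, ht, hs, rfl⟩, h⟩
    have hB : ∀ u ∈ {u : BlockTree.Shape | u.numNodes = 2 * m}, u.numNodes = 2 * m :=
      fun u hu => hu
    have hB' : ∀ k, 1 ≤ k → 2 ^ k ≤ 2 * m + 1 →
        ∃ u ∈ {u : BlockTree.Shape | u.numNodes = 2 * m}, BlockTree.hsFull u = k :=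
      fun k hk hkm => BlockTree.exists_numNodes_hsFull_eq k (2 * m) hk hkm
    simp only [BlockTree.IsEBT.valueSupport_pair_eq (hT₁ m) (hT₂ m) (hind m) glue,
      BlockTree.IsEBT.valueSupport_eq (hU m), BlockTree.hsFull_image_eq hm hA hA',
      BlockTree.hs_image_eq hm hA hA', BlockTree.hsFull_image_eq hm hB hB',
      BlockTree.hs_image_eq hm hB hB', and_self]
  · exact BlockTree.tendstoInProb_of_abs_sub_hsFull_le P tendsto_id hlog' hT₁ hT₂
      fun m ω => (hnear (hge _ _) (hle _ _)).1
  · exact BlockTree.tendstoInProb_of_abs_sub_hsFull_le P tendsto_id hlog' hT₁ hT₂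
      fun m ω => (hnear (hge _ _) (hle _ _)).2
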